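/- For a finite-dimensional complex Lie algebra $\mathfrak{g}$ and $f\in\mathfrak{g}^*$, let $\mathfrak{g}_f=\{x\in\mathfrak{g} : f([x,y])=0 \text{ for all } y\in\mathfrak{g}\}$ be the stabilizer of $f$ for the coadjoint action, and let $\chi[\mathfrak{g}]=\min\{\dim\mathfrak{g}_f : f\in\mathfrak{g}^*\}$ be the index of $\mathfrak{g}$. For positive integers $a_1,\dots,a_k$ with sum $n$, let $\mathfrak{p}(a_1,\dots,a_k)\subset\mathfrak{gl}(n,\mathbb{C})$ be the standard parabolic subalgebra consisting of the block upper triangular matrices whose diagonal blocks have sizes $a_1,\dots,a_k$, in this order. Let $(a_1,\dots,a_k)$ be a composition of an integer $n\ge 1$, i.e. $a_1,\dots,a_k$ are positive integers with $a_1+\cdots+a_k=n$. Then for every integer $\alpha\ge 1$, $$\chi[\mathfrak{p}(\alpha a_1,\dots,\alpha a_k)]=\alpha\,\chi[\mathfrak{p}(a_1,\dots,a_k)].$$ In particular, $\gcd(a_1,\dots,a_k)$ divides $\chi[\mathfrak{p}(a_1,\dots,a_k)]$. -/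

import Mathlib

/-- The stabilizer `{x ∈ L | f ⁅x, y⁆ = 0 for all y ∈ L}` of a linear form `f` on a Lie algebra `L`,
for the coadjoint action. -/
def coadjointStabilizer {K L : Type*} [Field K] [LieRing L] [LieAlgebra K L]
    (f : Module.Dual K L) : Submodule K L where
  carrier := {x | ∀ y : L, f ⁅x, y⁆ = 0}
  zero_mem' := fun y => by simp
  add_mem' := fun {x x'} hx hx' y => by simp [hx y, hx' y]
  smul_mem' := fun c x hx y => by simp [hx y]

/-- The index of a finite-dimensional Lie algebra `L`: the minimal dimension of the stabilizer of a
linear form, as the form ranges over the dual of `L`. -/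
noncomputable def lieIndex (K L : Type*) [Field K] [LieRing L] [LieAlgebra K L]
    [FiniteDimensional K L] : ℕ :=
  sInf (Set.range fun f : Module.Dual K L => Module.finrank K (coadjointStabilizer f))

/-- The block containing `x`, when the `a 0 + ⋯ + a (k - 1)` points are cut into consecutive
intervals of lengths `a 0, …, a (k - 1)`. -/
def blockOf {k : ℕ} (a : Fin k → ℕ) (x : Fin (∑ i, a i)) : Fin k :=
  (finSigmaFinEquiv.symm x).1

/- Square matrices carry the commutator bracket `⁅X, Y⁆ = X * Y - Y * X`. -/
attribute [local instance 100] LieRing.ofAssociativeRing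

/-- The standard parabolic subalgebra of `𝔤𝔩(n, ℂ)`, `n = a 0 + ⋯ + a (k - 1)`: the block upper
triangular matrices whose diagonal blocks have sizes `a 0, …, a (k - 1)`, in this order. -/
def parabolic {k : ℕ} (a : Fin k → ℕ) :
    LieSubalgebra ℂ (Matrix (Fin (∑ i, a i)) (Fin (∑ i, a i)) ℂ) where
  carrier := {X | X.BlockTriangular (blockOf a)}
  zero_mem' := Matrix.blockTriangular_zero
  add_mem' := fun hX hY => hX.add hY
  smul_mem' := fun c X hX i j hij => by simp [hX hij]
  lie_mem' := fun {X Y} hX hY => by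
    rw [Ring.lie_def]
    exact (Matrix.BlockTriangular.mul hX hY).sub (Matrix.BlockTriangular.mul hY hX)

/-! Let `q` be the algebra of matrices supported on a preorder `r`, with forms written as matrices
through the trace pairing. The stabilizer of `M` is then the space of `X` in `q` with `MX = XM` at
the positions the pairing sees. Scaling a composition by `α` replaces each entry of `q` by an `α ×
α` block.

Upper bound: for a block diagonal form with blocks `M k`, the block `(k, l)` of a stabilizing
element intertwines `M k` and `M l`. If the `M k` are regular and no two distinct ones have nonzero
intertwiners, the stabilizer has dimension `α` times the index of `q`.

Lower bound: with the same disjointness, `X ↦ (M k) X - X (M l)` is bijective from `q` to its dual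
for `k ≠ l`. Hence by the inverse function theorem every form near the block diagonal one is
conjugate to a block diagonal form, whose stabilizer contains those of its blocks
(`eventually_le_finrank_intertwiners`). Forms of minimal stabilizer dimension are dense, so one of
them lies in this neighbourhood.

Both bounds need a pair of forms without intertwiners (`HasDisjointForms`); semicontinuity then
makes this generic. The pair is built by induction on the size (`of_seaweed`), within seaweed
patterns because the reduction steps do not preserve parabolic ones. -/

/-- There are two linear forms `M`, `N` on the algebra of matrices supported on `r` such that no
nonzero element of the algebra intertwines them. Forms are represented by matrices supported on the
opposite relation, via the trace pairing. -/
def HasDisjointForms {ι : Type*} [Fintype ι] (r : ι → ι → Prop) : Prop :=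
  ∃ M N : Matrix ι ι ℂ, (∀ i j, ¬ r j i → M i j = 0) ∧ (∀ i j, ¬ r j i → N i j = 0) ∧
    ∀ X : Matrix ι ι ℂ, (∀ i j, ¬ r i j → X i j = 0) →
      (∀ i j, r j i → ∑ p, M i p * X p j = ∑ p, X i p * N p j) → ∀ i j, X i j = 0

/-! ### Reduction steps for pairs of disjoint forms -/

namespace HasDisjointForms

lemma of_bijective {ι κ : Type*} [Fintype ι] [Fintype κ] {r : ι → ι → Prop} (g : κ → ι)
    (hg : Function.Bijective g) (h : HasDisjointForms fun i j => r (g i) (g j)) :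
    HasDisjointForms r := by
  obtain ⟨M, N, hM, hN, H⟩ := h
  let e := Equiv.ofBijective g hg
  have hge : ∀ i, g (e.symm i) = i := e.apply_symm_apply
  refine ⟨fun i j => M (e.symm i) (e.symm j), fun i j => N (e.symm i) (e.symm j), ?_, ?_, ?_⟩
  · intro i j h; apply hM; simpa [hge] using h
  · intro i j h; apply hN; simpa [hge] using h
  · intro X hX hE i j
    have := H (fun i j => X (g i) (g j)) (fun i j h => hX _ _ h) (fun i j h => by
      have := hE _ _ h
      rw [← e.sum_comp, ← e.sum_comp] at this
      have h1 : ∀ i, e.symm (g i) = i := e.symm_apply_apply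
      simpa [h1, e] using this) (e.symm i) (e.symm j)
    simpa [hge] using this

lemma swap {ι : Type*} [Fintype ι] {r : ι → ι → Prop} (h : HasDisjointForms r) :
    HasDisjointForms fun i j => r j i := by
  obtain ⟨M, N, hM, hN, H⟩ := h
  refine ⟨fun i j => N j i, fun i j => M j i, fun i j h => hN _ _ h, fun i j h => hM _ _ h, ?_⟩
  intro X hX hE i j
  refine H (fun i j => X j i) (fun i j h => hX _ _ h) (fun i j h => ?_) j i
  simpa [mul_comm] using (hE j i h).symm

/-- An isolated full matrix block can be split off. -/
lemma sum_of_isolated {U Z : Type*} [Fintype U] [Fintype Z] {r : U ⊕ Z → U ⊕ Z → Prop}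
    (huu : ∀ u v, r (.inl u) (.inl v)) (huz : ∀ u z, ¬ r (.inl u) (.inr z))
    (hzu : ∀ z u, ¬ r (.inr z) (.inl u))
    (h : HasDisjointForms fun i j => r (.inr i) (.inr j)) : HasDisjointForms r := by
  classical
  obtain ⟨M, N, hM, hN, H⟩ := h
  -- On the isolated block, the forms identity and zero have no common intertwiner: the equation
  -- there reads `X = 0`.
  refine ⟨Matrix.fromBlocks 1 0 0 M, Matrix.fromBlocks 0 0 0 N, ?_, ?_, ?_⟩
  · rintro (i | i) (j | j) hij
    · exact absurd (huu _ _) hij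
    · rfl
    · rfl
    · exact hM _ _ hij
  · rintro (i | i) (j | j) hij
    · rfl
    · rfl
    · rfl
    · exact hN _ _ hij
  · intro X hX hE
    have h1 : ∀ u z, X (.inl u) (.inr z) = 0 := fun u z => hX _ _ (huz u z)
    have h2 : ∀ z u, X (.inr z) (.inl u) = 0 := fun z u => hX _ _ (hzu z u)
    have h3 : ∀ u v, X (.inl u) (.inl v) = 0 := fun u v => by
      have := hE (.inl u) (.inl v) (huu _ _)
      simpa [Fintype.sum_sum_type, Matrix.one_apply] using this
    have h4 := H (fun i j => X (.inr i) (.inr j)) (fun i j h => hX _ _ h) (fun i j h => by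
      have := hE (.inr i) (.inr j) h
      simpa [Fintype.sum_sum_type] using this)
    rintro (i | i) (j | j)
    exacts [h3 _ _, h1 _ _, h2 _ _, h4 _ _]

/-- Reduction at a minimal class `U` by a corner block matching `U` with a set `L` of maximal
elements (the second summand) of its up-set. The predicate `P` describes the part of the up-set
outside `U` and `L`. -/
lemma corner_reduction {U Z : Type*} [Fintype U] [Fintype Z]
    {r : U ⊕ (U ⊕ Z) → U ⊕ (U ⊕ Z) → Prop} {s : U ⊕ Z → U ⊕ Z → Prop} (P : Z → Prop)
    (huu : ∀ u v, r (.inl u) (.inl v)) (hul : ∀ u l, r (.inl u) (.inr (.inl l)))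
    (hru : ∀ i u, ¬ r (.inr i) (.inl u))
    (huz : ∀ u z, r (.inl u) (.inr (.inr z)) ↔ P z)
    (hzl : ∀ z l, P z → r (.inr (.inr z)) (.inr (.inl l)))
    (hsr : ∀ i j, s i j → r (.inr i) (.inr j))
    (hrs : ∀ i j, r (.inr i) (.inr j) → s i j ∨ ∃ z l, i = .inr z ∧ j = .inl l ∧ P z)
    (hs : ∀ z l, P z → ¬ s (.inr z) (.inl l))
    (h : HasDisjointForms s) : HasDisjointForms r := by
  classical
  obtain ⟨M, N, hM, hN, H⟩ := h
  let C : Matrix (U ⊕ Z) U ℂ := Matrix.fromRows 1 0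
  -- Both forms carry the same identity corner at `(L, U)`. The equations in the columns of `U` give
  -- `X_UL = 0`, `X_UU = X_LL`, and `X_ZL = 0` on the rows in `P`; the last cuts the support of the
  -- remaining part down to `s`.
  refine ⟨Matrix.fromBlocks 0 0 C M, Matrix.fromBlocks 0 0 C N, ?_, ?_, ?_⟩
  · rintro (i | (i | i)) (j | (j | j)) hij <;> try rfl
    · exact absurd (hul _ _) hij
    all_goals exact hM _ _ fun h => hij (hsr _ _ h)
  · rintro (i | (i | i)) (j | (j | j)) hij <;> try rfl
    · exact absurd (hul _ _) hij
    all_goals exact hN _ _ fun h => hij (hsr _ _ h)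
  · intro X hX hE
    have hru' : ∀ i u, X (.inr i) (.inl u) = 0 := fun i u => hX _ _ (hru i u)
    have hUL : ∀ u l, X (.inl u) (.inr (.inl l)) = 0 := fun u l => by
      have := hE (.inl u) (.inl l) (huu _ _)
      simpa [Fintype.sum_sum_type, C, Matrix.one_apply] using this.symm
    have hLU : ∀ l u, X (.inl l) (.inl u) = X (.inr (.inl l)) (.inr (.inl u)) := fun l u => by
      have := hE (.inr (.inl l)) (.inl u) (hul _ _)
      simpa [Fintype.sum_sum_type, C, Matrix.one_apply, hru'] using this
    have hZL : ∀ z l, P z → X (.inr (.inr z)) (.inr (.inl l)) = 0 := fun z l hz => by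
      have := hE (.inr (.inr z)) (.inl l) ((huz _ _).2 hz)
      simpa [Fintype.sum_sum_type, C, Matrix.one_apply, hru'] using this.symm
    have hmain := H (fun i j => X (.inr i) (.inr j)) (fun i j hij => by
        by_cases hr : r (.inr i) (.inr j)
        · obtain h | ⟨z, l, rfl, rfl, hz⟩ := hrs _ _ hr
          · exact absurd h hij
          · exact hZL _ _ hz
        · exact hX _ _ hr) (fun i j hij => by
      have := hE (.inr i) (.inr j) (hsr _ _ hij)
      rw [Fintype.sum_sum_type, Fintype.sum_sum_type] at this
      have h0 : ∀ u, C i u * X (.inl u) (.inr j) = 0 := by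
        intro u
        obtain i | i := i
        · obtain j | j := j
          · rw [hUL, mul_zero]
          · rw [hX _ _ fun h => hs _ _ ((huz _ _).1 h) hij, mul_zero]
        · simp [C]
      simpa [h0, hru'] using this)
    have hUZ : ∀ u z, X (.inl u) (.inr (.inr z)) = 0 := fun u z => by
      by_cases hz : P z
      · have := hE (.inr (.inl u)) (.inr (.inr z)) (hzl _ _ hz)
        rw [Fintype.sum_sum_type, Fintype.sum_sum_type] at this
        simpa [hmain, hru', C, Matrix.one_apply] using this
      · exact hX _ _ (mt (huz _ _).1 hz)
    rintro (i | i) (j | j)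
    · rw [hLU]; exact hmain _ _
    · obtain j | j := j
      exacts [hUL _ _, hUZ _ _]
    · exact hru' _ _
    · exact hmain _ _

/-- Reduction when the minimal class `U ⊕ W` is larger than the rest `L` of its up-set: a corner
block matches `L` (the second summand) with the part `U` of the minimal class, which is removed. -/
lemma corner_reduction' {U W Z : Type*} [Fintype U] [Fintype W] [Fintype Z]
    {r : U ⊕ (U ⊕ (W ⊕ Z)) → U ⊕ (U ⊕ (W ⊕ Z)) → Prop}
    (huu : ∀ u v, r (.inl u) (.inl v))
    (huw : ∀ u w, r (.inl u) (.inr (.inr (.inl w))))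
    (hwu : ∀ w u, r (.inr (.inr (.inl w))) (.inl u))
    (hul : ∀ u l, r (.inl u) (.inr (.inl l)))
    (hwl : ∀ w l, r (.inr (.inr (.inl w))) (.inr (.inl l)))
    (hlu : ∀ l u, ¬ r (.inr (.inl l)) (.inl u))
    (hlw : ∀ l w, ¬ r (.inr (.inl l)) (.inr (.inr (.inl w))))
    (huz : ∀ u z, ¬ r (.inl u) (.inr (.inr (.inr z))))
    (hzu : ∀ z u, ¬ r (.inr (.inr (.inr z))) (.inl u))
    (hwz : ∀ w z, ¬ r (.inr (.inr (.inl w))) (.inr (.inr (.inr z))))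
    (hzw : ∀ z w, ¬ r (.inr (.inr (.inr z))) (.inr (.inr (.inl w))))
    (hlz : ∀ l z, ¬ r (.inr (.inl l)) (.inr (.inr (.inr z))))
    (h : HasDisjointForms fun i j => r (.inr i) (.inr j)) : HasDisjointForms r := by
  classical
  obtain ⟨M, N, hM, hN, H⟩ := h
  -- The extended form has an identity corner at `(L, U)`, and the `(L, W)` block of the given form
  -- is moved to `(U, W)`. The equations then give `X_UU = X_LL`, `X_UW = 0`, `X_UL = M_LW X_WU` and
  -- `X_WL = M_WW X_WU`.
  let E : Matrix (U ⊕ (W ⊕ Z)) (U ⊕ (W ⊕ Z)) ℂ →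
      Matrix (U ⊕ (U ⊕ (W ⊕ Z))) (U ⊕ (U ⊕ (W ⊕ Z))) ℂ :=
    fun M i j => match i, j with
    | .inl u, .inr (.inr (.inl w)) => M (.inl u) (.inr (.inl w))
    | .inr (.inl l), .inl u => if l = u then 1 else 0
    | .inr (.inl l), .inr (.inl l') => M (.inl l) (.inl l')
    | .inr (.inl l), .inr (.inr (.inr z)) => M (.inl l) (.inr (.inr z))
    | .inr (.inr (.inl w)), .inr (.inr (.inl w')) => M (.inr (.inl w)) (.inr (.inl w'))
    | .inr (.inr (.inr z)), .inr (.inr (.inr z')) => M (.inr (.inr z)) (.inr (.inr z'))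
    | _, _ => 0
  have hE0 : ∀ M : Matrix (U ⊕ (W ⊕ Z)) (U ⊕ (W ⊕ Z)) ℂ,
      (∀ i j, ¬ r (.inr j) (.inr i) → M i j = 0) → ∀ i j, ¬ r j i → E M i j = 0 := by
    intro M hM
    rintro (i | (i | (i | i))) (j | (j | (j | j))) hij <;>
      first
      | rfl
      | exact hM _ _ hij
      | exact absurd (hul _ _) hij
      | exact absurd (hwu _ _) hij
  refine ⟨E M, E N, hE0 M hM, hE0 N hN, ?_⟩
  intro X hX hE
  have xlu := fun l u => hX _ _ (hlu l u)
  have xlw := fun l u => hX _ _ (hlw l u)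
  have xuz := fun l u => hX _ _ (huz l u)
  have xzu := fun l u => hX _ _ (hzu l u)
  have xwz := fun l u => hX _ _ (hwz l u)
  have xzw := fun l u => hX _ _ (hzw l u)
  have xlz := fun l u => hX _ _ (hlz l u)
  have mwl := fun u l => hM _ _ (hlw l u)
  have mzl := fun u l => hM _ _ (hlz l u)
  have mwz := fun u l => hM _ _ (hzw l u)
  have mzw := fun u l => hM _ _ (hwz l u)
  have nwl := fun u l => hN _ _ (hlw l u)
  have nzl := fun u l => hN _ _ (hlz l u)
  have nwz := fun u l => hN _ _ (hzw l u)
  have nzw := fun u l => hN _ _ (hwz l u)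
  have eLU : ∀ l u, X (.inl l) (.inl u) = X (.inr (.inl l)) (.inr (.inl u)) := fun l u => by
    simpa [Fintype.sum_sum_type, E, xlu, xlw, xzu] using hE (.inr (.inl l)) (.inl u) (hul _ _)
  have eLW : ∀ l w, X (.inl l) (.inr (.inr (.inl w))) = 0 := fun l w => by
    simpa [Fintype.sum_sum_type, E, xlu, xlw, xzw] using
      hE (.inr (.inl l)) (.inr (.inr (.inl w))) (hwl _ _)
  have eUU := fun u v => hE (.inl u) (.inl v) (huu _ _)
  have eWU := fun w u => hE (.inr (.inr (.inl w))) (.inl u) (huw _ _)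
  simp only [Fintype.sum_sum_type, E, zero_mul, mul_zero, Finset.sum_const_zero, zero_add,
    add_zero, mul_ite, mul_one, Finset.sum_ite_eq', Finset.mem_univ,
    if_true] at eUU eWU
  -- With `X_WU` in place of `X_WL`, the part of `X` outside `U` intertwines the smaller forms: at
  -- `(L, L)` the corner contributes `X_UL = M_LW X_WU`, and the `(L, W)` equation is the original
  -- one at `(U, W)`.
  let X' : Matrix (U ⊕ (W ⊕ Z)) (U ⊕ (W ⊕ Z)) ℂ := fun i j => match i, j with
    | .inr (.inl w), .inl l => X (.inr (.inr (.inl w))) (.inl l)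
    | i, j => X (.inr i) (.inr j)
  have hmain := H X' (by
      rintro (i | (i | i)) (j | (j | j)) hij <;>
        first
        | exact hX _ _ hij
        | exact absurd (hwl _ _) hij) (by
      rintro (i | (i | i)) (j | (j | j)) hij
      · simpa [Fintype.sum_sum_type, E, X', xlu, xlw, ← eUU, xlz, nzl, nwl, add_assoc,
          add_left_comm] using hE (.inr (.inl i)) (.inr (.inl j)) hij
      · simpa [Fintype.sum_sum_type, E, X', xlw, xlz, eLW, eLU, nzw, xzw] using
          hE (.inl i) (.inr (.inr (.inl j))) (hwu _ _)
      · simpa [Fintype.sum_sum_type, E, X', xlu, xlw, xuz, xwz, xlz] using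
          hE (.inr (.inl i)) (.inr (.inr (.inr j))) hij
      · exact absurd hij (hlw _ _)
      · simpa [Fintype.sum_sum_type, E, X', xlw, eLW, mwl, xzw, xwz] using
          hE (.inr (.inr (.inl i))) (.inr (.inr (.inl j))) hij
      · exact absurd hij (hzw _ _)
      · exact absurd hij (hlz _ _)
      · exact absurd hij (hwz _ _)
      · simpa [Fintype.sum_sum_type, E, X', xlz, xzw, xwz, mzl, xzu] using
          hE (.inr (.inr (.inr i))) (.inr (.inr (.inr j))) hij)
  have hwU : ∀ w u, X (.inr (.inr (.inl w))) (.inl u) = 0 :=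
    fun w u => hmain (.inr (.inl w)) (.inl u)
  rintro (i | (i | (i | i))) (j | (j | (j | j)))
  · rw [eLU]; exact hmain (.inl i) (.inl j)
  · simp [← eUU, hwU]
  · exact eLW _ _
  · exact xuz _ _
  · exact xlu _ _
  · exact hmain (.inl i) (.inl j)
  · exact xlw _ _
  · exact xlz _ _
  · exact hwU _ _
  · simp [← eWU, hwU]
  · exact hmain (.inr (.inl i)) (.inr (.inl j))
  · exact xwz _ _
  · exact xzu _ _
  · exact hmain (.inr (.inr i)) (.inl j)
  · exact xzw _ _
  · exact hmain (.inr (.inr i)) (.inr (.inr j))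

end HasDisjointForms

/-- Greedy choice of the largest values of `t`. It supplies the maximal set `L` required by
`corner_reduction`. -/
lemma Finset.exists_subset_card_eq_forall_le {ι : Type*} [DecidableEq ι] (t : ι → ℕ) (S : Finset ι)
    (a : ℕ) (ha : a ≤ S.card) :
    ∃ L ⊆ S, L.card = a ∧ ∀ z ∈ S \ L, ∀ l ∈ L, t z ≤ t l := by
  induction a with
  | zero => exact ⟨∅, by simp, rfl, by simp⟩
  | succ a ih =>
    obtain ⟨L, hLS, hL, H⟩ := ih (by omega)
    have hne : (S \ L).Nonempty := by
      rw [← Finset.card_pos, Finset.card_sdiff_of_subset hLS]; omega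
    obtain ⟨m, hm, hmax⟩ := Finset.exists_max_image (S \ L) t hne
    have hm' := Finset.mem_sdiff.1 hm
    refine ⟨insert m L, Finset.insert_subset hm'.1 hLS, ?_, ?_⟩
    · rw [Finset.card_insert_of_notMem hm'.2, hL]
    · intro z hz l hl
      simp only [Finset.mem_sdiff, Finset.mem_insert, not_or] at hz
      have hz' : z ∈ S \ L := Finset.mem_sdiff.2 ⟨hz.1, hz.2.2⟩
      obtain rfl | hl := Finset.mem_insert.1 hl
      exacts [hmax _ hz', H _ hz' _ hl]

/-! ### Disjoint forms for seaweed patterns -/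

/-- The pattern of the seaweed algebra whose first flag is given by the levels of `t` and whose
opposite flag is given by the levels of `b`. -/
def seaweed {ι : Type*} (t b : ι → ℕ) (i j : ι) : Prop := t i ≤ t j ∧ b j ≤ b i

namespace HasDisjointForms

/-- Inductive step when the lowest level `T` of `t` lies inside the lowest level of `b`. The latter
is then the up-set of `T`; let `B` be its part outside `T`. If `B` is empty, `T` is isolated;
otherwise the sizes of `T` and `B` decide which corner reduction applies. The hypothesis `htb` says
that the two flags are compatible with a common ordering, and it survives each reduction. -/
lemma seaweed_aux {ι : Type} [Fintype ι] (t b : ι → ℕ)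
    (htb : ∀ i j, t i < t j → b i ≤ b j)
    (ih : ∀ (κ : Type) [Fintype κ] (t b : κ → ℕ), Fintype.card κ < Fintype.card ι →
      (∀ i j, t i < t j → b i ≤ b j) → HasDisjointForms (seaweed t b))
    (t₀ b₀ : ℕ) (ht₀ : ∀ i, t₀ ≤ t i) (hb₀ : ∀ i, b₀ ≤ b i) (hne : ∃ i, t i = t₀)
    (hTB : ∀ i, t i = t₀ → b i = b₀) : HasDisjointForms (seaweed t b) := by
  classical
  have key : ∀ i j, t i = t₀ → b j ≠ b₀ → ¬ seaweed t b i j ∧ ¬ seaweed t b j i := by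
    intro i j hi hj
    have h1 := hTB i hi
    have h2 := hb₀ j
    have h3 : t j ≠ t₀ := fun h => hj (hTB j h)
    have h4 := ht₀ j
    constructor
    · rintro ⟨-, h⟩; omega
    · rintro ⟨h, -⟩; omega
  have up : ∀ i j, t i = t₀ → b j = b₀ → seaweed t b i j := fun i j hi hj =>
    ⟨hi ▸ ht₀ j, by rw [hj, hTB i hi]⟩
  have notup : ∀ i j, t i = t₀ → t j ≠ t₀ → ¬ seaweed t b j i := fun i j hi hj h =>
    hj (le_antisymm (hi ▸ h.1) (ht₀ j))
  let T : Finset ι := Finset.univ.filter fun i => t i = t₀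
  let B : Finset ι := Finset.univ.filter fun i => b i = b₀ ∧ t i ≠ t₀
  have hT : ∀ i, i ∈ T ↔ t i = t₀ := fun i => by simp [T]
  have hB : ∀ i, i ∈ B ↔ b i = b₀ ∧ t i ≠ t₀ := fun i => by simp [B]
  obtain ⟨i₀, hi₀⟩ := hne
  by_cases hBe : B = ∅
  · have hBe' : ∀ i, t i ≠ t₀ → b i ≠ b₀ := fun i h h' => by
      have := (hB i).2 ⟨h', h⟩
      simp [hBe] at this
    refine of_bijective (κ := {i // t i = t₀} ⊕ {i // t i ≠ t₀}) (Sum.elim Subtype.val Subtype.val)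
      (Equiv.sumCompl _).bijective ?_
    refine sum_of_isolated (fun u v => up _ _ u.2 (hTB _ v.2))
      (fun u z => (key _ _ u.2 (hBe' _ z.2)).1) (fun z u => (key _ _ u.2 (hBe' _ z.2)).2) ?_
    exact ih {i // t i ≠ t₀} (fun i => t i) (fun i => b i)
      (Fintype.card_subtype_lt (x := i₀) (by simpa using hi₀)) fun i j => htb _ _
  obtain ⟨l₀, hl₀⟩ := Finset.nonempty_iff_ne_empty.2 hBe
  obtain hTB' | hBT := le_or_gt T.card B.card
  · obtain ⟨L, hLB, hLT, hL⟩ := Finset.exists_subset_card_eq_forall_le t B _ hTB'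
    have e : {i // i ∈ T} ≃ {i // i ∈ L} := Fintype.equivOfCardEq (by simp [hLT])
    let g : {i // i ∈ T} ⊕ ({i // i ∈ T} ⊕ {i // i ∉ T ∧ i ∉ L}) → ι :=
      Sum.elim Subtype.val (Sum.elim (fun i => (e i).1) Subtype.val)
    have eL : ∀ i, (e i).1 ∈ L := fun i => (e i).2
    have hLt : ∀ i ∈ L, b i = b₀ ∧ t i ≠ t₀ := fun i h => (hB i).1 (hLB h)
    have hg : Function.Bijective g := by
      constructor
      · rintro (i | (i | i)) (j | (j | j)) hij <;> simp only [g, Sum.elim_inl, Sum.elim_inr] at hij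
        · rw [Subtype.ext hij]
        · exact absurd ((hT _).1 i.2) (hij ▸ (hLt _ (eL j)).2)
        · exact absurd (hij ▸ i.2) j.2.1
        · exact absurd ((hT _).1 j.2) (hij ▸ (hLt _ (eL i)).2)
        · rw [e.injective (Subtype.ext hij)]
        · exact absurd (hij ▸ eL i) j.2.2
        · exact absurd (hij ▸ j.2) i.2.1
        · exact absurd (hij ▸ eL j) i.2.2
        · rw [Subtype.ext hij]
      · intro i
        by_cases h : i ∈ T
        · exact ⟨.inl ⟨i, h⟩, rfl⟩
        by_cases h' : i ∈ L
        · exact ⟨.inr (.inl (e.symm ⟨i, h'⟩)), by simp [g]⟩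
        · exact ⟨.inr (.inr ⟨i, h, h'⟩), rfl⟩
    have hcard : Fintype.card ({i // i ∈ T} ⊕ {i // i ∉ T ∧ i ∉ L}) < Fintype.card ι := by
      have hc := Fintype.card_of_bijective hg
      rw [Fintype.card_sum] at hc
      have : 0 < Fintype.card {i // i ∈ T} := Fintype.card_pos_iff.2 ⟨⟨i₀, (hT _).2 hi₀⟩⟩
      omega
    have tT : ∀ u : {i // i ∈ T}, t u = t₀ := fun u => (hT _).1 u.2
    have tZ : ∀ z : {i // i ∉ T ∧ i ∉ L}, t z ≠ t₀ := fun z h => z.2.1 ((hT _).2 h)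
    have hbL : ∀ u, b (e u) = b₀ := fun u => (hLt _ (eL u)).1
    have htL : ∀ u, t (e u) ≠ t₀ := fun u => (hLt _ (eL u)).2
    have hmax : ∀ (z : {i // i ∉ T ∧ i ∉ L}) l, b z = b₀ → t z ≤ t (e l) := fun z l hz =>
      hL z (Finset.mem_sdiff.2 ⟨(hB _).2 ⟨hz, tZ z⟩, z.2.2⟩) _ (eL l)
    refine of_bijective g hg ?_
    -- Doubling `b` makes room for a new level `2 * b₀ + 1` holding `L`, just above the rest of `B`
    -- at `2 * b₀`. This removes exactly the relations from `B \ L` to `L`.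
    refine corner_reduction (s := seaweed (fun i => t (g (.inr i)))
      (Sum.elim (fun _ => 2 * b₀ + 1) fun z => 2 * b z)) (fun z => b z = b₀)
      (fun u v => up _ _ (tT u) (hTB _ (tT v))) (fun u l => up _ _ (tT u) (hbL l)) ?_
      (fun u z => ⟨fun h => by_contra fun h' => (key _ _ (tT u) h').1 h, up _ _ (tT u)⟩)
      (fun z l hz => ⟨hmax z l hz, (hbL l).le.trans (hb₀ _)⟩) ?_ ?_ ?_ (ih _ _ _ hcard ?_)
    · rintro (i | i) u
      · exact notup _ _ (tT u) (htL i)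
      · exact notup _ _ (tT u) (tZ i)
    · rintro (i | i) (j | j) ⟨h1, h2⟩ <;> simp only [Sum.elim_inl, Sum.elim_inr] at h2 <;>
        refine ⟨h1, ?_⟩ <;> simp only [g, Sum.elim_inl, Sum.elim_inr, hbL]
      · rfl
      · have := hb₀ j; omega
      · exact hb₀ _
      · omega
    · rintro (i | i) (j | j) ⟨h1, h2⟩ <;> simp only [g, Sum.elim_inl, Sum.elim_inr] at h2
      · exact Or.inl ⟨h1, le_rfl⟩
      · left
        refine ⟨h1, ?_⟩
        rw [hbL] at h2
        simp only [Sum.elim_inl, Sum.elim_inr]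
        omega
      · by_cases hz : b i = b₀
        · exact Or.inr ⟨_, _, rfl, rfl, hz⟩
        · left
          refine ⟨h1, ?_⟩
          have := hb₀ i
          simp only [Sum.elim_inl, Sum.elim_inr]
          omega
      · left
        refine ⟨h1, ?_⟩
        simp only [Sum.elim_inr]
        omega
    · rintro z l hz ⟨-, h⟩
      simp only [Sum.elim_inl, Sum.elim_inr] at h
      omega
    · rintro (i | i) (j | j) h <;> simp only [g, Sum.elim_inl, Sum.elim_inr] at h ⊢
      · rfl
      · have h1 := hb₀ j
        have h2 : b j ≠ b₀ := fun h' => by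
          have := hmax j i h'
          omega
        omega
      · have := htb _ _ h
        rw [hbL] at this
        omega
      · have := htb _ _ h
        omega
  -- Here `B` is smaller than `T`: only a part `U` of `T` of the size of `B` is removed, and the
  -- levels of the other points stay unchanged.
  · obtain ⟨U, hUT, hUB⟩ := Finset.exists_subset_card_eq hBT.le
    have e : {i // i ∈ U} ≃ {i // i ∈ B} := Fintype.equivOfCardEq (by simp [hUB])
    let g : {i // i ∈ U} ⊕ ({i // i ∈ U} ⊕ ({i // i ∈ T ∧ i ∉ U} ⊕ {i // i ∉ T ∧ i ∉ B})) → ι :=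
      Sum.elim Subtype.val (Sum.elim (fun i => (e i).1) (Sum.elim Subtype.val Subtype.val))
    have eB : ∀ i, (e i).1 ∈ B := fun i => (e i).2
    have hBT' : ∀ i ∈ B, i ∉ T := fun i hi h => ((hB i).1 hi).2 ((hT i).1 h)
    have hg : Function.Bijective g := by
      constructor
      · rintro (i | (i | (i | i))) (j | (j | (j | j))) hij <;>
          simp only [g, Sum.elim_inl, Sum.elim_inr] at hij
        · rw [Subtype.ext hij]
        · exact absurd (hUT i.2) (hij ▸ hBT' _ (eB j))
        · exact absurd (hij ▸ i.2) j.2.2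
        · exact absurd (hij ▸ hUT i.2) j.2.1
        · exact absurd (hUT j.2) (hij ▸ hBT' _ (eB i))
        · rw [e.injective (Subtype.ext hij)]
        · exact absurd (hij ▸ j.2.1) (hBT' _ (eB i))
        · exact absurd (hij ▸ eB i) j.2.2
        · exact absurd (hij ▸ j.2) i.2.2
        · exact absurd (hij ▸ i.2.1) (hBT' _ (eB j))
        · rw [Subtype.ext hij]
        · exact absurd (hij ▸ i.2.1) j.2.1
        · exact absurd (hij ▸ hUT j.2) i.2.1
        · exact absurd (hij ▸ eB j) i.2.2
        · exact absurd (hij ▸ j.2.1) i.2.1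
        · rw [Subtype.ext hij]
      · intro i
        by_cases h : i ∈ T
        · by_cases h' : i ∈ U
          · exact ⟨.inl ⟨i, h'⟩, rfl⟩
          · exact ⟨.inr (.inr (.inl ⟨i, h, h'⟩)), rfl⟩
        by_cases h' : i ∈ B
        · exact ⟨.inr (.inl (e.symm ⟨i, h'⟩)), by simp [g]⟩
        · exact ⟨.inr (.inr (.inr ⟨i, h, h'⟩)), rfl⟩
    have hcard : Fintype.card ({i // i ∈ U} ⊕ ({i // i ∈ T ∧ i ∉ U} ⊕ {i // i ∉ T ∧ i ∉ B})) <
        Fintype.card ι := by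
      have hc := Fintype.card_of_bijective hg
      rw [Fintype.card_sum] at hc
      have : 0 < Fintype.card {i // i ∈ U} := Fintype.card_pos_iff.2 ⟨e.symm ⟨l₀, hl₀⟩⟩
      omega
    have tU : ∀ u : {i // i ∈ U}, t u = t₀ := fun u => (hT _).1 (hUT u.2)
    have tW : ∀ u : {i // i ∈ T ∧ i ∉ U}, t u = t₀ := fun u => (hT _).1 u.2.1
    have bZ : ∀ z : {i // i ∉ T ∧ i ∉ B}, b z ≠ b₀ := fun z h =>
      z.2.2 ((hB _).2 ⟨h, fun h' => z.2.1 ((hT _).2 h')⟩)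
    have hbL : ∀ u, b (e u) = b₀ := fun u => ((hB _).1 (eB u)).1
    have htL : ∀ u, t (e u) ≠ t₀ := fun u => ((hB _).1 (eB u)).2
    refine of_bijective g hg (corner_reduction' (fun u v => up _ _ (tU u) (hTB _ (tU v)))
      (fun u v => up _ _ (tU u) (hTB _ (tW v))) (fun u v => up _ _ (tW u) (hTB _ (tU v)))
      (fun u v => up _ _ (tU u) (hbL v)) (fun u v => up _ _ (tW u) (hbL v))
      (fun l u => notup _ _ (tU u) (htL l))
      (fun l u => notup _ _ (tW u) (htL l)) (fun u z => (key _ _ (tU u) (bZ z)).1)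
      (fun z u => (key _ _ (tU u) (bZ z)).2) (fun u z => (key _ _ (tW u) (bZ z)).1)
      (fun z u => (key _ _ (tW u) (bZ z)).2) (fun l z h => ?_)
      (ih _ _ _ hcard fun i j => htb (g (.inr i)) (g (.inr j))))
    exact bZ z (le_antisymm (h.2.trans (hbL l).le) (hb₀ _))

/-- By compatibility, one of the two lowest levels contains the other. Exchanging `t` and `b`
transposes the pattern, so `swap` reduces to the case of `seaweed_aux`. -/
theorem of_seaweed {ι : Type} [Fintype ι] (t b : ι → ℕ)
    (htb : ∀ i j, t i < t j → b i ≤ b j) : HasDisjointForms (seaweed t b) := by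
  induction hn : Fintype.card ι using Nat.strong_induction_on generalizing ι with
  | _ n ih =>
  subst hn
  have ih' : ∀ (κ : Type) [Fintype κ] (t b : κ → ℕ), Fintype.card κ < Fintype.card ι →
      (∀ i j, t i < t j → b i ≤ b j) → HasDisjointForms (seaweed t b) :=
    fun κ _ t b h htb => ih _ h t b htb rfl
  obtain h | h := isEmpty_or_nonempty ι
  · exact ⟨0, 0, fun i => h.elim i, fun i => h.elim i, fun _ _ _ i => h.elim i⟩
  obtain ⟨i, hi⟩ := Finite.exists_min t
  obtain ⟨j, hj⟩ := Finite.exists_min b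
  by_cases hTB : ∀ x, t x = t i → b x = b j
  · exact seaweed_aux t b htb ih' _ _ hi hj ⟨i, rfl⟩ hTB
  · push Not at hTB
    obtain ⟨x, hx, hxb⟩ := hTB
    have := seaweed_aux b t (fun i j h => le_of_not_gt fun h' => (htb _ _ h').not_gt h)
      ih' _ _ hj hi ⟨j, rfl⟩ (fun y hy => by
        by_contra hne
        have h1 := htb x y (hx ▸ lt_of_le_of_ne (hi y) (Ne.symm hne))
        exact hxb (le_antisymm (hy ▸ h1) (hj x)))
    refine cast ?_ this.swap
    congr 1
    ext i j
    exact and_comm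

end HasDisjointForms

/-! ### Semicontinuity of kernels and a slice for conjugation -/

open Topology in
/-- In a linear family of linear maps, the dimension of the kernel is generically at most its value
at any given member. -/
lemma exists_isOpen_dense_finrank_ker_le {E V W : Type*} [AddCommGroup E] [Module ℂ E]
    [TopologicalSpace E] [IsTopologicalAddGroup E] [ContinuousSMul ℂ E] [T2Space E]
    [FiniteDimensional ℂ E] [AddCommGroup V] [Module ℂ V] [FiniteDimensional ℂ V]
    [AddCommGroup W] [Module ℂ W] (φ : E →ₗ[ℂ] V →ₗ[ℂ] W) (F₁ : E) :
    ∃ O : Set E, IsOpen O ∧ Dense O ∧ ∀ F ∈ O,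
      Module.finrank ℂ (LinearMap.ker (φ F)) ≤ Module.finrank ℂ (LinearMap.ker (φ F₁)) := by
  obtain ⟨C, hC⟩ := (LinearMap.ker (φ F₁)).exists_isCompl
  obtain ⟨π, hπ⟩ := ((φ F₁).comp C.subtype).exists_leftInverse_of_injective (by
    rw [LinearMap.ker_comp, ← Submodule.disjoint_iff_comap_eq_bot]
    exact hC.disjoint.symm)
  let A : E →ₗ[ℂ] C →ₗ[ℂ] C := (LinearMap.llcomp ℂ C W C π).comp
    ((LinearMap.lcomp ℂ W C.subtype).comp φ)
  have hA : ∀ F x, A F x = π (φ F x) := fun F x => rfl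
  let b := Module.finBasis ℂ C
  let D : E →ₗ[ℂ] Matrix _ _ ℂ := (LinearMap.toMatrix b b).toLinearMap.comp A
  have hD : ∀ F, D F = LinearMap.toMatrix b b (A F) := fun F => rfl
  have hD1 : D F₁ = 1 := by
    rw [hD, show A F₁ = LinearMap.id from hπ, LinearMap.toMatrix_id]
  have hcont : Continuous D := D.continuous_of_finiteDimensional
  -- Density: since `D F₁ = 1`, the determinant at `s • F₁ + F` is the characteristic polynomial of
  -- `-D F` at `s`, which has finitely many roots. Where it is nonzero, the kernel meets `C`
  -- trivially.
  refine ⟨{F | (D F).det ≠ 0}, isOpen_ne.preimage hcont.matrix_det, fun F => ?_, fun F hF => ?_⟩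
  · let c : ℂ → E := fun s => s • F₁ + F
    have hc : Continuous c := by fun_prop
    have hfin : {s : ℂ | ((-D F).charpoly).IsRoot s}.Finite :=
      Polynomial.finite_setOfPred_isRoot (Matrix.charpoly_monic _).ne_zero
    have h0 : (0 : ℂ) ∈ closure {s : ℂ | ((-D F).charpoly).IsRoot s}ᶜ :=
      (hfin.countable.dense_compl ℂ) 0
    have := image_closure_subset_closure_image hc (Set.mem_image_of_mem c h0)
    simp only [c, zero_smul, zero_add] at this
    refine closure_mono ?_ this
    rintro _ ⟨s, hs, rfl⟩
    simp only [Set.mem_compl_iff, Set.mem_ofPred_eq, Polynomial.IsRoot, Matrix.eval_charpoly] at hs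
    simpa [hD1, Matrix.smul_one_eq_diagonal, Matrix.scalar_apply] using hs
  · have hdisj : Disjoint (LinearMap.ker (φ F)) C := by
      rw [Submodule.disjoint_def]
      intro x hx hxC
      have hx' : A F ⟨x, hxC⟩ = 0 := by
        rw [hA]; rw [LinearMap.mem_ker] at hx; simp [hx]
      have hdet : LinearMap.det (A F) ≠ 0 := by
        rwa [← LinearMap.det_toMatrix b]
      have hinj := ((A F).equivOfDetNeZero hdet).injective
      have : (⟨x, hxC⟩ : C) = 0 := hinj (by simpa using hx')
      simpa using congrArg Subtype.val this
    have h1 := Submodule.finrank_add_finrank_le_of_disjoint hdisj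
    have h2 := Submodule.finrank_add_eq_of_isCompl hC
    omega

open Topology in
/-- A slice for conjugation: if `P` moves `F₀` transversally to `Q`, every element near `F₀` is
conjugate into `Q`. -/
lemma eventually_conj_mem {A : Type*} [NormedRing A] [NormedAlgebra ℂ A] [FiniteDimensional ℂ A]
    (P Q : Submodule ℂ A) (F₀ : A) (hF₀ : F₀ ∈ Q)
    (H : ∀ Y, ∃ v ∈ P, ∃ h ∈ Q, v * F₀ - F₀ * v + h = Y) :
    ∀ᶠ F in 𝓝 F₀, ∃ v ∈ P, ∃ G ∈ Q, IsUnit (1 + v) ∧ F * (1 + v) = (1 + v) * G := by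
  have : CompleteSpace A := FiniteDimensional.complete ℂ A
  have : CompleteSpace (P × Q) := FiniteDimensional.complete ℂ _
  let p₀ : P × Q := (0, ⟨F₀, hF₀⟩)
  let Φ : P × Q → A := fun p => (1 + (p.1 : A)) * (p.2 : A) * Ring.inverse (1 + (p.1 : A))
  let LP : P × Q →L[ℂ] A := P.subtypeL.comp (ContinuousLinearMap.fst ℂ P Q)
  let LQ : P × Q →L[ℂ] A := Q.subtypeL.comp (ContinuousLinearMap.snd ℂ P Q)
  have h1 : HasStrictFDerivAt (fun p : P × Q => 1 + (p.1 : A)) LP p₀ :=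
    LP.hasStrictFDerivAt.const_add 1
  have h2 : HasStrictFDerivAt (fun p : P × Q => (p.2 : A)) LQ p₀ := LQ.hasStrictFDerivAt
  have h3 := hasStrictFDerivAt_ringInverse (𝕜 := ℂ) (1 : Aˣ)
  rw [show ((1 : Aˣ) : A) = 1 + (p₀.1 : A) by simp [p₀]] at h3
  -- The derivative of `Φ` at `(0, F₀)` is `(v, h) ↦ v * F₀ - F₀ * v + h`, surjective by `H`; so `Φ`
  -- maps neighbourhoods onto neighbourhoods.
  have hΦ := (h1.mul' h2).mul' (h3.comp p₀ h1)
  have hmap := hΦ.map_nhds_eq_of_surj (by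
    rw [LinearMap.range_eq_top]
    intro Y
    obtain ⟨v, hv, h, hh, rfl⟩ := H Y
    refine ⟨(⟨v, hv⟩, ⟨h, hh⟩), ?_⟩
    simp [p₀, LP, LQ]
    abel)
  have hS : {p : P × Q | IsUnit (1 + (p.1 : A))} ∈ 𝓝 p₀ := by
    refine (Units.isOpen.preimage (f := fun p : P × Q => 1 + (p.1 : A)) (by fun_prop)).mem_nhds ?_
    simp [p₀]
  have him := Filter.image_mem_map (m := Φ) hS
  have hval : Φ p₀ = F₀ := by simp [Φ, p₀]
  rw [show Filter.map Φ (𝓝 p₀) = 𝓝 (Φ p₀) from hmap, hval] at him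
  filter_upwards [him]
  rintro _ ⟨⟨v, G⟩, hp, rfl⟩
  refine ⟨v, v.2, G, G.2, hp, ?_⟩
  simp only [Φ]
  rw [mul_assoc, Ring.inverse_mul_cancel _ hp, mul_one]

/-! ### Matrices supported on a relation and their intertwiners -/

section Pattern

variable {ι : Type*}

open Classical in
/-- The matrix with given entries at the positions in `r` and zeros elsewhere. -/
noncomputable def patternMatrix (r : ι → ι → Prop) :
    ({p : ι × ι // r p.1 p.2} → ℂ) →ₗ[ℂ] Matrix ι ι ℂ where
  toFun x := Matrix.of fun i j => if h : r i j then x ⟨(i, j), h⟩ else 0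
  map_add' x y := by ext i j; by_cases h : r i j <;> simp [h]
  map_smul' c x := by ext i j; by_cases h : r i j <;> simp [h]

lemma patternMatrix_of_mem (r : ι → ι → Prop) (x : {p : ι × ι // r p.1 p.2} → ℂ) {i j : ι}
    (h : r i j) : patternMatrix r x i j = x ⟨(i, j), h⟩ := by simp [patternMatrix, h]

lemma patternMatrix_of_not_mem (r : ι → ι → Prop) (x : {p : ι × ι // r p.1 p.2} → ℂ) {i j : ι}
    (h : ¬ r i j) : patternMatrix r x i j = 0 := by simp [patternMatrix, h]

lemma patternMatrix_injective (r : ι → ι → Prop) : Function.Injective (patternMatrix r) := by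
  intro x y h
  ext ⟨⟨i, j⟩, hp⟩
  simpa [patternMatrix_of_mem r _ hp] using congrFun (congrFun h i) j

lemma patternMatrix_restrict {r : ι → ι → Prop} {X : Matrix ι ι ℂ}
    (hX : ∀ i j, ¬ r i j → X i j = 0) : patternMatrix r (fun p => X p.1.1 p.1.2) = X := by
  ext i j
  by_cases h : r i j
  · rw [patternMatrix_of_mem r _ h]
  · rw [patternMatrix_of_not_mem r _ h, hX _ _ h]

variable [Fintype ι]

/-- The matrices supported on `r` that intertwine the linear forms `M` and `N` on the space of all
such matrices, the forms being given by the trace pairing. -/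
def intertwiners (r : ι → ι → Prop) (M N : Matrix ι ι ℂ) : Submodule ℂ (Matrix ι ι ℂ) where
  carrier := {X | (∀ i j, ¬ r i j → X i j = 0) ∧ ∀ i j, r j i → (M * X - X * N) i j = 0}
  zero_mem' := by simp
  add_mem' := fun {X Y} hX hY => ⟨fun i j h => by simp [hX.1 i j h, hY.1 i j h], fun i j h => by
    rw [mul_add, add_mul, add_sub_add_comm, Matrix.add_apply, hX.2 i j h, hY.2 i j h, add_zero]⟩
  smul_mem' := fun c X hX => ⟨fun i j h => by simp [hX.1 i j h], fun i j h => by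
    rw [mul_smul_comm, smul_mul_assoc, ← smul_sub, Matrix.smul_apply, hX.2 i j h, smul_zero]⟩

/-- The index of the Lie algebra of matrices supported on `r`. -/
noncomputable def patternIndex (r : ι → ι → Prop) : ℕ :=
  sInf (Set.range fun M : Matrix ι ι ℂ => Module.finrank ℂ (intertwiners r M M))

lemma patternIndex_le (r : ι → ι → Prop) (M : Matrix ι ι ℂ) :
    patternIndex r ≤ Module.finrank ℂ (intertwiners r M M) :=
  Nat.sInf_le ⟨M, rfl⟩

lemma exists_finrank_eq_patternIndex (r : ι → ι → Prop) :
    ∃ M : Matrix ι ι ℂ, Module.finrank ℂ (intertwiners r M M) = patternIndex r :=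
  Nat.sInf_mem (Set.range_nonempty _)

lemma HasDisjointForms.exists_intertwiners_eq_bot {r : ι → ι → Prop} (h : HasDisjointForms r) :
    ∃ M N : Matrix ι ι ℂ, intertwiners r M N = ⊥ := by
  obtain ⟨M, N, -, -, H⟩ := h
  refine ⟨M, N, (Submodule.eq_bot_iff _).2 fun X hX => ?_⟩
  ext i j
  refine H X hX.1 (fun i j h => ?_) i j
  simpa [Matrix.mul_apply, sub_eq_zero] using hX.2 i j h

/-- The action of pairs of linear forms on the matrices supported on `r` whose kernels are the
spaces of intertwiners, in coordinates. -/
noncomputable def intertwineMap (r : ι → ι → Prop) : (Matrix ι ι ℂ × Matrix ι ι ℂ) →ₗ[ℂ]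
    ({p : ι × ι // r p.1 p.2} → ℂ) →ₗ[ℂ] ({p : ι × ι // r p.1 p.2} → ℂ) :=
  LinearMap.mk₂ ℂ (fun F x p => (F.1 * patternMatrix r x - patternMatrix r x * F.2) p.1.2 p.1.1)
    (fun F G x => by ext p; simp [add_mul, mul_add]; ring)
    (fun c F x => by ext p; simp [mul_sub])
    (fun F x y => by ext p; simp [add_mul, mul_add]; ring)
    (fun c F x => by ext p; simp [mul_sub])

lemma intertwineMap_apply (r : ι → ι → Prop) (F : Matrix ι ι ℂ × Matrix ι ι ℂ)
    (x : {p : ι × ι // r p.1 p.2} → ℂ) (p : {p : ι × ι // r p.1 p.2}) : intertwineMap r F x p =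
      (F.1 * patternMatrix r x - patternMatrix r x * F.2) p.1.2 p.1.1 := rfl

lemma mem_ker_intertwineMap {r : ι → ι → Prop} {F : Matrix ι ι ℂ × Matrix ι ι ℂ}
    {x : {p : ι × ι // r p.1 p.2} → ℂ} :
    x ∈ LinearMap.ker (intertwineMap r F) ↔ patternMatrix r x ∈ intertwiners r F.1 F.2 := by
  rw [LinearMap.mem_ker]
  constructor
  · intro h
    exact ⟨fun i j hij => patternMatrix_of_not_mem r _ hij, fun i j hij => congrFun h ⟨(j, i), hij⟩⟩
  · intro h
    ext p
    exact h.2 _ _ p.2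

lemma finrank_intertwiners (r : ι → ι → Prop) (F : Matrix ι ι ℂ × Matrix ι ι ℂ) :
    Module.finrank ℂ (intertwiners r F.1 F.2) =
      Module.finrank ℂ (LinearMap.ker (intertwineMap r F)) := by
  have : intertwiners r F.1 F.2 = (LinearMap.ker (intertwineMap r F)).map (patternMatrix r) := by
    ext X
    constructor
    · intro hX
      refine ⟨fun p => X p.1.1 p.1.2, ?_, patternMatrix_restrict hX.1⟩
      exact mem_ker_intertwineMap.2 (by rwa [patternMatrix_restrict hX.1])
    · rintro ⟨x, hx, rfl⟩
      exact mem_ker_intertwineMap.1 hx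
  rw [this]
  exact (Submodule.equivMapOfInjective _ (patternMatrix_injective r) _).finrank_eq.symm

/-- If two forms have no intertwiners, the dual equation can be solved. -/
lemma exists_of_intertwiners_eq_bot {r : ι → ι → Prop} {M N : Matrix ι ι ℂ}
    (h : intertwiners r M N = ⊥) (Y : Matrix ι ι ℂ) :
    ∃ X : Matrix ι ι ℂ, (∀ i j, ¬ r i j → X i j = 0) ∧
      ∀ i j, r j i → (M * X - X * N) i j = Y i j := by
  have hinj : Function.Injective (intertwineMap r (M, N)) := by
    rw [← LinearMap.ker_eq_bot, ← Submodule.finrank_eq_zero, ← finrank_intertwiners, h,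
      finrank_bot]
  obtain ⟨x, hx⟩ := LinearMap.injective_iff_surjective.1 hinj fun p => Y p.1.2 p.1.1
  exact ⟨patternMatrix r x, fun i j hij => patternMatrix_of_not_mem r _ hij,
    fun i j hij => congrFun hx ⟨(j, i), hij⟩⟩

variable [DecidableEq ι] {r : ι → ι → Prop}

/-- The algebra of matrices supported on a preorder `r`. -/
def patternAlgebra (hr : ∀ i, r i i) (ht : ∀ i j k, r i j → r j k → r i k) :
    Subalgebra ℂ (Matrix ι ι ℂ) where
  carrier := {X | ∀ i j, ¬ r i j → X i j = 0}
  mul_mem' := fun {X Y} hX hY i j h => by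
    rw [Matrix.mul_apply]
    refine Finset.sum_eq_zero fun k _ => ?_
    by_cases hik : r i k
    · rw [hY k j fun hkj => h (ht _ _ _ hik hkj), mul_zero]
    · rw [hX i k hik, zero_mul]
  add_mem' := fun {X Y} hX hY i j h => by simp [hX i j h, hY i j h]
  algebraMap_mem' := fun c i j h => by
    rw [Matrix.algebraMap_matrix_apply, if_neg]
    rintro rfl
    exact h (hr i)

/-- Left multiplication by `g` is injective on the finite-dimensional space `S`, so it reaches `1`.
-/
lemma exists_inverse_mem (S : Subalgebra ℂ (Matrix ι ι ℂ)) {g : Matrix ι ι ℂ} (hg : g ∈ S)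
    (hu : IsUnit g) : ∃ h ∈ S, g * h = 1 ∧ h * g = 1 := by
  let m : S →ₗ[ℂ] S := LinearMap.mulLeft ℂ ⟨g, hg⟩
  have hm : Function.Injective m := fun x y hxy =>
    Subtype.ext (hu.mul_left_cancel (congrArg Subtype.val hxy))
  obtain ⟨h, hh⟩ := LinearMap.injective_iff_surjective.1 hm 1
  have h1 : g * h = 1 := congrArg Subtype.val hh
  exact ⟨h, h.2, h1, mul_eq_one_comm.1 h1⟩

/-- Conjugation by `g` embeds one stabilizer in the other. The equations hold only at positions
opposite to `r`; transitivity ensures that multiplying by elements of the algebra preserves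
vanishing there. -/
lemma finrank_intertwiners_le_of_conj (hr : ∀ i, r i i) (ht : ∀ i j k, r i j → r j k → r i k)
    {F G g : Matrix ι ι ℂ} (hg : g ∈ patternAlgebra hr ht) (hu : IsUnit g)
    (hFG : F * g = g * G) :
    Module.finrank ℂ (intertwiners r G G) ≤ Module.finrank ℂ (intertwiners r F F) := by
  obtain ⟨h, hh, hgh, hhg⟩ := exists_inverse_mem _ hg hu
  have hFG' : h * F = G * h := by
    calc h * F = h * (F * g) * h := by rw [mul_assoc, mul_assoc, hgh, mul_one]
      _ = G * h := by rw [hFG, ← mul_assoc, hhg, one_mul]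
  let c : Matrix ι ι ℂ →ₗ[ℂ] Matrix ι ι ℂ := (LinearMap.mulLeft ℂ g).comp (LinearMap.mulRight ℂ h)
  have hc : ∀ X, c X = g * (X * h) := fun X => rfl
  have hcinj : Function.Injective c := by
    intro X Y hXY
    simp only [hc] at hXY
    have h1 := hu.mul_left_cancel hXY
    calc X = X * h * g := by rw [mul_assoc, hhg, mul_one]
      _ = Y := by rw [h1, mul_assoc, hhg, mul_one]
  rw [(Submodule.equivMapOfInjective c hcinj (intertwiners r G G)).finrank_eq]
  refine Submodule.finrank_mono ?_
  rintro _ ⟨X, hX, rfl⟩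
  refine ⟨Subalgebra.mul_mem _ hg (Subalgebra.mul_mem _ hX.1 hh), fun i j hij => ?_⟩
  have : F * c X - c X * F = g * ((G * X - X * G) * h) := by
    rw [hc, ← mul_assoc, hFG, mul_assoc g (X * h), mul_assoc X, hFG']
    noncomm_ring
  rw [this, Matrix.mul_apply]
  refine Finset.sum_eq_zero fun p _ => ?_
  by_cases hip : r i p
  · rw [Matrix.mul_apply, Finset.sum_eq_zero fun q _ => ?_, mul_zero]
    by_cases hqj : r q j
    · rw [hX.2 _ _ (ht _ _ _ hqj (ht _ _ _ hij hip)), zero_mul]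
    · rw [hh q j hqj, mul_zero]
  · rw [hg i p hip, zero_mul]

end Pattern

/-! ### Replacing entries by blocks multiplies the index -/

section Inflation

variable {ι : Type*} [Fintype ι] {r : ι → ι → Prop} {α : ℕ}

/-- The pattern obtained from `r` by replacing each entry by an `α × α` block. -/
def inflate (α : ℕ) (r : ι → ι → Prop) (p q : ι × Fin α) : Prop := r p.1 q.1

/-- The block of index `(k, l)`. -/
def subBlock (X : Matrix (ι × Fin α) (ι × Fin α) ℂ) (k l : Fin α) : Matrix ι ι ℂ :=
  Matrix.of fun i j => X (i, k) (j, l)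

lemma blockDiagonal_mul_apply (M : Fin α → Matrix ι ι ℂ) (X : Matrix (ι × Fin α) (ι × Fin α) ℂ)
    (i j : ι) (k l : Fin α) :
    (Matrix.blockDiagonal M * X) (i, k) (j, l) = (M k * subBlock X k l) i j := by
  simp [Matrix.mul_apply, Fintype.sum_prod_type, Matrix.blockDiagonal_apply, subBlock]

lemma mul_blockDiagonal_apply (M : Fin α → Matrix ι ι ℂ) (X : Matrix (ι × Fin α) (ι × Fin α) ℂ)
    (i j : ι) (k l : Fin α) :
    (X * Matrix.blockDiagonal M) (i, k) (j, l) = (subBlock X k l * M l) i j := by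
  simp [Matrix.mul_apply, Fintype.sum_prod_type, Matrix.blockDiagonal_apply, subBlock]

/-- For block diagonal forms the intertwining condition can be checked on blocks. -/
lemma mem_intertwiners_blockDiagonal {M : Fin α → Matrix ι ι ℂ}
    {X : Matrix (ι × Fin α) (ι × Fin α) ℂ} :
    X ∈ intertwiners (inflate α r) (Matrix.blockDiagonal M) (Matrix.blockDiagonal M) ↔
      ∀ k l, subBlock X k l ∈ intertwiners r (M k) (M l) := by
  constructor
  · intro h k l
    refine ⟨fun i j hij => h.1 (i, k) (j, l) hij, fun i j hij => ?_⟩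
    have := h.2 (i, k) (j, l) hij
    rwa [Matrix.sub_apply, blockDiagonal_mul_apply, mul_blockDiagonal_apply] at this
  · intro h
    refine ⟨fun p q hpq => (h p.2 q.2).1 p.1 q.1 hpq, fun p q hpq => ?_⟩
    obtain ⟨i, k⟩ := p
    obtain ⟨j, l⟩ := q
    rw [Matrix.sub_apply, blockDiagonal_mul_apply, mul_blockDiagonal_apply]
    exact (h k l).2 i j hpq

/-- The off-diagonal blocks of a stabilizing element vanish by `hM`, so its diagonal blocks
determine it. -/
lemma finrank_intertwiners_blockDiagonal_le {M : Fin α → Matrix ι ι ℂ}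
    (hM : ∀ k l, k ≠ l → intertwiners r (M k) (M l) = ⊥) :
    Module.finrank ℂ (intertwiners (inflate α r) (Matrix.blockDiagonal M)
      (Matrix.blockDiagonal M)) ≤ ∑ k, Module.finrank ℂ (intertwiners r (M k) (M k)) := by
  rw [← Module.finrank_pi_fintype]
  let c : intertwiners (inflate α r) (Matrix.blockDiagonal M) (Matrix.blockDiagonal M) →ₗ[ℂ]
      ∀ k, intertwiners r (M k) (M k) :=
    { toFun := fun X k => ⟨subBlock X k k, mem_intertwiners_blockDiagonal.1 X.2 k k⟩
      map_add' := fun _ _ => rfl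
      map_smul' := fun _ _ => rfl }
  refine LinearMap.finrank_le_finrank_of_injective (f := c) ?_
  rw [injective_iff_map_eq_zero]
  intro X hX
  ext ⟨i, k⟩ ⟨j, l⟩
  have hkl : subBlock X.1 k l = 0 := by
    obtain rfl | hkl := eq_or_ne k l
    · exact congrArg Subtype.val (congrFun hX k)
    · have := mem_intertwiners_blockDiagonal.1 X.2 k l
      rwa [hM k l hkl, Submodule.mem_bot] at this
  exact congrFun (congrFun hkl i) j

lemma sum_finrank_intertwiners_le (M : Fin α → Matrix ι ι ℂ) :
    ∑ k, Module.finrank ℂ (intertwiners r (M k) (M k)) ≤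
      Module.finrank ℂ (intertwiners (inflate α r) (Matrix.blockDiagonal M)
        (Matrix.blockDiagonal M)) := by
  rw [← Module.finrank_pi_fintype]
  have hsub : ∀ (X : Fin α → Matrix ι ι ℂ) k l,
      subBlock (Matrix.blockDiagonal X) k l = if k = l then X k else 0 := by
    intro X k l
    ext i j
    by_cases h : k = l <;> simp [subBlock, Matrix.blockDiagonal_apply, h]
  let c : (∀ k, intertwiners r (M k) (M k)) →ₗ[ℂ]
      intertwiners (inflate α r) (Matrix.blockDiagonal M) (Matrix.blockDiagonal M) :=
    { toFun := fun X => ⟨Matrix.blockDiagonal fun k => (X k : Matrix ι ι ℂ),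
        mem_intertwiners_blockDiagonal.2 fun k l => by
          rw [hsub]
          split_ifs with h
          · subst h; exact (X k).2
          · exact zero_mem _⟩
      map_add' := fun X Y => Subtype.ext
        (Matrix.blockDiagonal_add (fun k => (X k).1) fun k => (Y k).1)
      map_smul' := fun a X => Subtype.ext (Matrix.blockDiagonal_smul a fun k => (X k).1) }
  refine LinearMap.finrank_le_finrank_of_injective (f := c) ?_
  intro X Y hXY
  have h : (fun k => (X k : Matrix ι ι ℂ)) = fun k => (Y k : Matrix ι ι ℂ) :=
    Matrix.blockDiagonal_injective (congrArg Subtype.val hXY)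
  funext k
  exact Subtype.ext (congrFun h k)

/-- The intertwiners depend only on the restriction of the form to the algebra. -/
lemma intertwiners_congr {κ : Type*} [Fintype κ] {r : κ → κ → Prop}
    (ht : ∀ i j k, r i j → r j k → r i k) {F G : Matrix κ κ ℂ}
    (h : ∀ i j, r j i → F i j = G i j) : intertwiners r F F ≤ intertwiners r G G := by
  intro X hX
  refine ⟨hX.1, fun i j hij => ?_⟩
  rw [← hX.2 i j hij, Matrix.sub_apply, Matrix.sub_apply, Matrix.mul_apply, Matrix.mul_apply,
    Matrix.mul_apply, Matrix.mul_apply]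
  congr 1 <;> refine Finset.sum_congr rfl fun p _ => ?_
  · by_cases hp : r p j
    · rw [h _ _ (ht _ _ _ hp hij)]
    · rw [hX.1 _ _ hp, mul_zero, mul_zero]
  · by_cases hp : r i p
    · rw [h _ _ (ht _ _ _ hij hp)]
    · rw [hX.1 _ _ hp, zero_mul, zero_mul]

/-- Generic tuples of forms are regular and have no intertwiners between distinct members. -/
lemma exists_generic_forms (hd : HasDisjointForms r) (α : ℕ) : ∃ M : Fin α → Matrix ι ι ℂ,
    (∀ k, Module.finrank ℂ (intertwiners r (M k) (M k)) ≤ patternIndex r) ∧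
    ∀ k l, k ≠ l → intertwiners r (M k) (M l) = ⊥ := by
  obtain ⟨M₀, hM₀⟩ := exists_finrank_eq_patternIndex r
  obtain ⟨M₁, M₂, h12⟩ := hd.exists_intertwiners_eq_bot
  let φ : Fin α × Fin α → (Fin α → Matrix ι ι ℂ) →ₗ[ℂ] _ := fun p =>
    (intertwineMap r).comp ((LinearMap.proj p.1).prod (LinearMap.proj p.2))
  -- A witness for each pair: a regular form on the diagonal, the disjoint forms `M₁`, `M₂` off it.
  -- The finitely many open dense conditions so obtained hold simultaneously at some tuple.
  let F₁ : Fin α × Fin α → Fin α → Matrix ι ι ℂ := fun p k =>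
    if p.1 = p.2 then M₀ else if k = p.1 then M₁ else M₂
  choose O hO hdense hF using fun p => exists_isOpen_dense_finrank_ker_le (φ p) (F₁ p)
  obtain ⟨M, hM⟩ := (Set.Finite.dense_sInter (Set.finite_range O) (by rintro _ ⟨p, rfl⟩; exact hO p)
    (by rintro _ ⟨p, rfl⟩; exact hdense p)).nonempty
  have hM' : ∀ k l, Module.finrank ℂ (intertwiners r (M k) (M l)) ≤
      Module.finrank ℂ (intertwiners r (F₁ (k, l) k) (F₁ (k, l) l)) := fun k l => by
    rw [finrank_intertwiners r (M k, M l), finrank_intertwiners r (F₁ (k, l) k, F₁ (k, l) l)]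
    exact hF (k, l) M (hM _ ⟨_, rfl⟩)
  refine ⟨M, fun k => ?_, fun k l hkl => ?_⟩
  · have := hM' k k
    rwa [show F₁ (k, k) k = M₀ from if_pos rfl, hM₀] at this
  · have := hM' k l
    rw [show F₁ (k, l) k = M₁ by simp [F₁, hkl], show F₁ (k, l) l = M₂ by simp [F₁, hkl, hkl.symm],
      h12, finrank_bot] at this
    exact Submodule.finrank_eq_zero.1 (Nat.le_zero.1 this)

variable [DecidableEq ι]

attribute [local instance] Matrix.linftyOpNormedRing Matrix.linftyOpNormedAlgebra

open Topology in
/-- Every form near a block diagonal form with disjoint blocks is, up to the coadjoint action, block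
diagonal; hence the lower bound for its stabilizer. -/
lemma eventually_le_finrank_intertwiners (hr : ∀ i, r i i)
    (ht : ∀ i j k, r i j → r j k → r i k) {M : Fin α → Matrix ι ι ℂ}
    (hM : ∀ k l, k ≠ l → intertwiners r (M k) (M l) = ⊥) :
    ∀ᶠ F in 𝓝 (Matrix.blockDiagonal M), α * patternIndex r ≤
      Module.finrank ℂ (intertwiners (inflate α r) F F) := by
  have ht' : ∀ i j k, inflate α r i j → inflate α r j k → inflate α r i k :=
    fun i j k => ht i.1 j.1 k.1
  let S := patternAlgebra (r := inflate α r) (fun i => hr i.1) ht'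
  -- Only entries visible to the algebra are required to be block diagonal, because the dual
  -- equation is solvable only at those positions; all other entries are free in `Q`.
  let Q : Submodule ℂ (Matrix (ι × Fin α) (ι × Fin α) ℂ) :=
    { carrier := {G | ∀ i j, i.2 ≠ j.2 → inflate α r j i → G i j = 0}
      zero_mem' := by simp
      add_mem' := fun {X Y} hX hY i j h h' => by simp [hX i j h h', hY i j h h']
      smul_mem' := fun c X hX i j h h' => by simp [hX i j h h'] }
  have hconj := eventually_conj_mem S.toSubmodule Q (Matrix.blockDiagonal M)
    (fun i j h _ => Matrix.blockDiagonal_apply_ne M _ _ h) (fun Y => by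
      -- The sign in `-Y` is due to the order of the commutator: the slice needs `v * M - M * v`,
      -- the dual equation gives `M * X - X * M`.
      choose! X hX hXY using fun k l (h : k ≠ l) =>
        exists_of_intertwiners_eq_bot (hM k l h) (subBlock (-Y) k l)
      let v : Matrix (ι × Fin α) (ι × Fin α) ℂ := Matrix.of fun p q =>
        if p.2 = q.2 then 0 else X p.2 q.2 p.1 q.1
      have hv : ∀ k l, k ≠ l → subBlock v k l = X k l := fun k l h => by
        ext i j; simp [subBlock, v, h]
      refine ⟨v, fun p q hpq => ?_, Y - (v * Matrix.blockDiagonal M - Matrix.blockDiagonal M * v),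
        ?_, by abel⟩
      · by_cases h : p.2 = q.2
        · simp [v, h]
        · simpa [v, h] using hX _ _ h p.1 q.1 hpq
      · rintro ⟨i, k⟩ ⟨j, l⟩ h hij
        have := hXY k l h i j hij
        rw [Matrix.sub_apply, Matrix.sub_apply, blockDiagonal_mul_apply, mul_blockDiagonal_apply,
          hv k l h]
        simp only [Matrix.sub_apply, subBlock, Matrix.of_apply, Matrix.neg_apply] at this
        linear_combination this)
  filter_upwards [hconj]
  rintro F ⟨v, hv, G, hG, hu, hFG⟩
  refine le_trans ?_ (finrank_intertwiners_le_of_conj (fun i => hr i.1) ht'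
    (S.add_mem S.one_mem hv) hu hFG)
  let N : Fin α → Matrix ι ι ℂ := fun k => subBlock G k k
  calc α * patternIndex r = ∑ _k : Fin α, patternIndex r := by simp
    _ ≤ ∑ k, Module.finrank ℂ (intertwiners r (N k) (N k)) :=
      Finset.sum_le_sum fun k _ => patternIndex_le r (N k)
    _ ≤ _ := sum_finrank_intertwiners_le N
    _ ≤ _ := Submodule.finrank_mono (intertwiners_congr ht' fun i j hij => by
      by_cases h : i.2 = j.2
      · obtain ⟨i, k⟩ := i
        obtain ⟨j, l⟩ := j
        obtain rfl : k = l := h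
        simp [Matrix.blockDiagonal_apply, N, subBlock]
      · rw [Matrix.blockDiagonal_apply_ne N _ _ h, hG i j h hij])

theorem patternIndex_inflate (hr : ∀ i, r i i) (ht : ∀ i j k, r i j → r j k → r i k)
    (hd : HasDisjointForms r) (α : ℕ) : patternIndex (inflate α r) = α * patternIndex r := by
  obtain ⟨M, hreg, hM⟩ := exists_generic_forms hd α
  apply le_antisymm
  · calc _ ≤ _ := patternIndex_le _ (Matrix.blockDiagonal M)
      _ ≤ _ := finrank_intertwiners_blockDiagonal_le hM
      _ ≤ ∑ _k : Fin α, patternIndex r := Finset.sum_le_sum fun k _ => hreg k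
      _ = _ := by simp
  -- A minimizing `F₁` need not be near the block diagonal form, but density gives a form near it
  -- whose stabilizer is no larger.
  · obtain ⟨F₁, hF₁⟩ := exists_finrank_eq_patternIndex (inflate α r)
    obtain ⟨O, -, hdense, hOF⟩ := exists_isOpen_dense_finrank_ker_le
      ((intertwineMap (inflate α r)).comp (LinearMap.id.prod LinearMap.id)) F₁
    obtain ⟨F, hFO, hF⟩ := hdense.inter_nhds_nonempty (eventually_le_finrank_intertwiners hr ht hM)
    have := hOF F hFO
    simp only [LinearMap.comp_apply] at this
    rw [← finrank_intertwiners, ← finrank_intertwiners] at this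
    exact (hF.trans this).trans hF₁.le

end Inflation

/-! ### From the Lie algebra index to the pattern index -/

section Parabolic

variable {k : ℕ} {κ : Type*}

lemma mem_parabolic {a : Fin k → ℕ} {X : Matrix (Fin (∑ i, a i)) (Fin (∑ i, a i)) ℂ} :
    X ∈ parabolic a ↔ ∀ i j, ¬ blockOf a i ≤ blockOf a j → X i j = 0 := by
  simp only [not_le]
  exact Iff.rfl

/-- The parabolic subalgebra as the space of matrices supported on a pattern, in coordinates. -/
noncomputable def parabolicEquiv (a : Fin k → ℕ) (e : Fin (∑ i, a i) ≃ κ) {r : κ → κ → Prop}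
    (he : ∀ x y, r (e x) (e y) ↔ blockOf a x ≤ blockOf a y) :
    parabolic a ≃ₗ[ℂ] ({p : κ × κ // r p.1 p.2} → ℂ) where
  toFun X p := X.1 (e.symm p.1.1) (e.symm p.1.2)
  map_add' _ _ := rfl
  map_smul' _ _ := rfl
  invFun x := ⟨(patternMatrix r x).submatrix e e, mem_parabolic.2 fun i j h =>
    patternMatrix_of_not_mem r x (mt (he i j).1 h)⟩
  left_inv X := by
    ext i j
    by_cases h : r (e i) (e j)
    · simp [patternMatrix_of_mem r _ h]
    · simp [patternMatrix_of_not_mem r _ h, mem_parabolic.1 X.2 i j (mt (he i j).2 h)]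
  right_inv x := by
    ext p
    simp [patternMatrix_of_mem r x p.2]

lemma patternMatrix_parabolicEquiv (a : Fin k → ℕ) (e : Fin (∑ i, a i) ≃ κ) {r : κ → κ → Prop}
    (he : ∀ x y, r (e x) (e y) ↔ blockOf a x ≤ blockOf a y) (X : parabolic a) :
    patternMatrix r (parabolicEquiv a e he X) = X.1.submatrix e.symm e.symm := by
  ext i j
  by_cases h : r i j
  · rw [patternMatrix_of_mem r _ h]; rfl
  · rw [patternMatrix_of_not_mem r _ h]
    refine (mem_parabolic.1 X.2 _ _ fun h' => h ?_).symm
    simpa using (he _ _).2 h'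

variable [Fintype κ]

lemma trace_mul_patternMatrix (r : κ → κ → Prop) [Fintype {p : κ × κ // r p.1 p.2}]
    (A : Matrix κ κ ℂ) (y : {p : κ × κ // r p.1 p.2} → ℂ) :
    (A * patternMatrix r y).trace = ∑ p, A p.1.2 p.1.1 * y p := by
  classical
  have h1 : ∑ p, A p.1.2 p.1.1 * y p =
      ∑ p : {p : κ × κ // r p.1 p.2}, A p.1.2 p.1.1 * patternMatrix r y p.1.1 p.1.2 :=
    Finset.sum_congr rfl fun p _ => by rw [patternMatrix_of_mem r y p.2]
  rw [h1, Matrix.trace]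
  simp only [Matrix.diag, Matrix.mul_apply]
  rw [Finset.sum_comm, ← Fintype.sum_prod_type' fun i j => A j i * patternMatrix r y i j,
    ← Finset.sum_subtype (Finset.univ.filter fun p : κ × κ => r p.1 p.2) (by simp)
      fun p => A p.2 p.1 * patternMatrix r y p.1 p.2]
  refine (Finset.sum_filter_of_ne fun p _ hp => ?_).symm
  by_contra h
  exact hp (by rw [patternMatrix_of_not_mem r y h, mul_zero])

/-- Every form on the algebra is `X ↦ tr (M X)` for some `M`, and `tr (M [X, Y]) = tr ((M X - X M)
Y)`; so the stabilizer of the form is the space of self-intertwiners of `M`. -/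
theorem lieIndex_parabolic (a : Fin k → ℕ) (e : Fin (∑ i, a i) ≃ κ) {r : κ → κ → Prop}
    (he : ∀ x y, r (e x) (e y) ↔ blockOf a x ≤ blockOf a y) :
    lieIndex ℂ (parabolic a) = patternIndex r := by
  classical
  let Θ := parabolicEquiv a e he
  have hmul : ∀ X Y : Matrix (Fin (∑ i, a i)) (Fin (∑ i, a i)) ℂ,
      (X * Y).submatrix e.symm e.symm = X.submatrix e.symm e.symm * Y.submatrix e.symm e.symm :=
    fun X Y => (Matrix.submatrix_mul_equiv X Y _ e.symm _).symm
  have key : ∀ (f : Module.Dual ℂ (parabolic a)) (M : Matrix κ κ ℂ),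
      (∀ X, f X = (M * patternMatrix r (Θ X)).trace) →
      Module.finrank ℂ (coadjointStabilizer f) = Module.finrank ℂ (intertwiners r M M) := by
    intro f M hfM
    rw [finrank_intertwiners r (M, M)]
    have hmap : coadjointStabilizer f =
        (LinearMap.ker (intertwineMap r (M, M))).comap (Θ : parabolic a →ₗ[ℂ] _) := by
      ext X
      have h1 : ∀ Y : parabolic a, f ⁅X, Y⁆ = ∑ p, intertwineMap r (M, M) (Θ X) p * Θ Y p := by
        intro Y
        simp only [intertwineMap_apply]
        rw [hfM, ← trace_mul_patternMatrix]
        simp only [Θ, patternMatrix_parabolicEquiv, LieSubalgebra.coe_bracket, Ring.lie_def,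
          Matrix.submatrix_sub, Pi.sub_apply, hmul, mul_sub, sub_mul, Matrix.trace_sub]
        congr 1
        · rw [mul_assoc]
        · rw [Matrix.trace_mul_comm, mul_assoc, Matrix.trace_mul_comm, mul_assoc]
      change (∀ Y, f ⁅X, Y⁆ = 0) ↔ intertwineMap r (M, M) (Θ X) = 0
      constructor
      · intro h
        ext p
        have := h (Θ.symm (Pi.single p 1))
        rw [h1] at this
        simpa [Pi.single_apply] using this
      · intro h Y
        rw [h1, h]
        simp
    rw [hmap, Submodule.comap_equiv_eq_map_symm, LinearEquiv.finrank_map_eq]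
  unfold lieIndex patternIndex
  congr 1
  ext d
  constructor
  · rintro ⟨f, rfl⟩
    let M : Matrix κ κ ℂ := fun i j => if h : r j i then f (Θ.symm (Pi.single ⟨(j, i), h⟩ 1)) else 0
    refine ⟨M, (key f M fun X => ?_).symm⟩
    rw [trace_mul_patternMatrix]
    have : X = Θ.symm (Θ X) := (Θ.symm_apply_apply X).symm
    conv_lhs => rw [this, pi_eq_sum_univ' (Θ X), map_sum, map_sum]
    refine Finset.sum_congr rfl fun p _ => ?_
    rw [map_smul, map_smul, smul_eq_mul, mul_comm, show M p.1.2 p.1.1 = _ from dif_pos p.2]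
  · rintro ⟨M, rfl⟩
    let f : Module.Dual ℂ (parabolic a) :=
      (Matrix.traceLinearMap κ ℂ ℂ).comp ((LinearMap.mulLeft ℂ M).comp
        ((patternMatrix r).comp (Θ : parabolic a →ₗ[ℂ] _)))
    exact ⟨f, key f M fun X => rfl⟩

end Parabolic

/-! ### Scaling of compositions and the conclusion -/

/-- The cells of a composition `a`, multiplied by `α`. -/
def scaledCells {k : ℕ} (a : Fin k → ℕ) (α : ℕ) :
    Fin (∑ i, α * a i) ≃ (Σ i, Fin (a i)) × Fin α :=
  finSigmaFinEquiv.symm.trans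
    { toFun := fun x => (⟨x.1, (finProdFinEquiv.symm x.2).2⟩, (finProdFinEquiv.symm x.2).1)
      invFun := fun x => ⟨x.1.1, finProdFinEquiv (x.2, x.1.2)⟩
      left_inv := fun x => Sigma.ext rfl (heq_of_eq (finProdFinEquiv.apply_symm_apply x.2))
      right_inv := fun x => by simp }

/-- A parabolic is a seaweed with trivial second flag, and only the block of a cell matters for the
pattern; the scaled parabolic is therefore the inflation of the original one. -/
theorem lieIndex_parabolic_mul {k : ℕ} (a : Fin k → ℕ) (α : ℕ) :
    lieIndex ℂ (parabolic fun i => α * a i) = α * lieIndex ℂ (parabolic a) := by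
  let t : (Σ i, Fin (a i)) → ℕ := fun x => x.1
  rw [lieIndex_parabolic a finSigmaFinEquiv.symm (r := seaweed t fun _ => 0)
      (fun x y => by simp [seaweed, t, blockOf]),
    lieIndex_parabolic (fun i => α * a i) (scaledCells a α)
      (r := inflate α (seaweed t fun _ => 0))
      (fun x y => by simp [inflate, seaweed, t, blockOf, scaledCells])]
  exact patternIndex_inflate (fun i => ⟨le_rfl, le_rfl⟩)
    (fun i j k h h' => ⟨h.1.trans h'.1, h'.2.trans h.2⟩)
    (HasDisjointForms.of_seaweed _ _ fun _ _ _ => le_rfl) α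

theorem mainTheorem10 (n : ℕ) (hn : 0 < n) (k : ℕ) (a : Fin k → ℕ)
    (ha : ∀ i, 0 < a i) (hsum : ∑ i, a i = n) :
    (∀ α : ℕ, 0 < α →
      lieIndex ℂ (parabolic fun i => α * a i) = α * lieIndex ℂ (parabolic a)) ∧
    Finset.univ.gcd a ∣ lieIndex ℂ (parabolic a) := by
  refine ⟨fun α _ => lieIndex_parabolic_mul a α, ?_⟩
  -- Divisibility is the scaling formula applied to `b`, the composition divided by its gcd.
  obtain ⟨b, hb⟩ : ∃ b : Fin k → ℕ, a = fun i => Finset.univ.gcd a * b i :=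
    ⟨fun i => a i / Finset.univ.gcd a, funext fun i =>
      (Nat.mul_div_cancel' (Finset.gcd_dvd (Finset.mem_univ i))).symm⟩
  generalize Finset.univ.gcd a = d at hb
  subst hb
  exact ⟨_, lieIndex_parabolic_mul b d⟩
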